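/- Infinite words are indexed from $0$. A pair $(1,a)$ with $a\ge 2$ is a pseudoperiod of an infinite word $w=w_0w_1w_2\cdots$ if $w_i\in\{w_{i+1},w_{i+a}\}$ for all $i\ge 0$. The exponent of a finite nonempty word $x$ is $|x|/p$, where $p$ is the smallest period of $x$; an infinite word avoids $3^+$-powers if all its nonempty finite factors have exponent at most $3$. Let ${\bf t}=01101001\cdots$ be the Thue–Morse word, the fixed point starting with $0$ of the morphism $0\mapsto 01$, $1\mapsto 10$. A morphism is $n$-uniform if the image of every letter has length $n$. **Theorem.** (1) For at least 85% of all integers $a\ge 3$ there is an infinite binary word with pseudoperiod $(1,a)$ that avoids $3^+$-powers. Precisely: for all sufficiently large $N$, at least $85\%$ of the integers $a$ with $3\le a\le N$ have this property. (2) More precisely, for each of the following $19$ residue classes $i \pmod n$: $$4\ (5);\quad 3\ (7);\quad 4,8\ (9);\quad 4,5,7,8,10\ (11);\quad 5,8\ (13);\quad 4,9,13\ (14);\quad 7\ (15);\quad 4,6,10,15\ (16)$$ (the modulus $n$ is in parentheses), there is an $n$-uniform morphism $h:\{0,1\}^*\to\{0,1\}^*$ such that $h({\bf t})$ avoids $3^+$-powers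 and has pseudoperiod $(1,a)$ for every integer $a\ge 3$ with $a\equiv i \pmod n$. (3) Exactly $629772$ of the $720720$ residues modulo $720720={\rm lcm}(5,7,9,11,13,14,15,16)$ belong to at least one of these residue classes. -/

import Mathlib

/-- The tuple `p 0 < p 1 < ⋯ < p (k - 1)` of `k ≥ 1` positive integers is a pseudoperiod of the
infinite word `w`: every letter `w i` is one of `w (i + p 0), …, w (i + p (k - 1))`. -/
def HasPseudoperiod {α : Type*} (w : ℕ → α) {k : ℕ} (p : Fin k → ℕ) : Prop :=
  0 < k ∧ (∀ j, 0 < p j) ∧ StrictMono p ∧ ∀ i, ∃ j, w i = w (i + p j)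

/-- `p` is a period of the finite word `x`: `1 ≤ p ≤ |x|` and `x_i = x_{i+p}` for
`0 ≤ i < |x| - p`. -/
def IsPeriod {α : Type*} (x : List α) (p : ℕ) : Prop :=
  1 ≤ p ∧ p ≤ x.length ∧ ∀ i, i + p < x.length → x[i]? = x[i + p]?

/-- The exponent `|x| / p` of a finite nonempty word `x`, where `p` is its smallest period.
(A nonempty word always has the period `|x|`.) -/
noncomputable def wordExponent {α : Type*} (x : List α) : ℝ :=
  (x.length : ℝ) / (sInf {p : ℕ | IsPeriod x p} : ℕ)

/-- The factor `w_i w_{i+1} ⋯ w_{i+n-1}` of length `n` of the infinite word `w`. -/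
def wordFactor {α : Type*} (w : ℕ → α) (i n : ℕ) : List α :=
  (List.range n).map fun j => w (i + j)

/-- The infinite word `w` avoids `e⁺`-powers (is `e⁺`-free): every nonempty finite factor of `w`
has exponent at most `e`. -/
def AvoidsPlusPowers {α : Type*} (e : ℝ) (w : ℕ → α) : Prop :=
  ∀ i n, 0 < n → wordExponent (wordFactor w i n) ≤ e

/-- The morphism of finite words with letter images `h` is `n`-uniform. -/
def IsUniformMorphism {α β : Type*} (n : ℕ) (h : α → List β) : Prop :=
  ∀ a, (h a).length = n

/-- The image `h (w 0) h (w 1) h (w 2) ⋯` of the infinite binary word `w` under the morphism with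
letter images `h`, all of which are assumed nonempty. Its letter at position `m` is read off from
the image of the prefix of `w` of length `m + 1`, which has length at least `m + 1`; so the default
value of `getD` is never used. -/
def morphicImage (h : Fin 2 → List (Fin 2)) (w : ℕ → Fin 2) : ℕ → Fin 2 :=
  fun m => ((wordFactor w 0 (m + 1)).flatMap h).getD m 0

/-- The letter images of the Thue-Morse morphism `0 ↦ 01`, `1 ↦ 10`. -/
def thueMorseMorphism : Fin 2 → List (Fin 2) :=
  ![[0, 1], [1, 0]]

/-- The Thue-Morse word `0110 1001 ⋯`, the infinite fixed point of the Thue-Morse morphism that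
starts with `0`: its letter at position `m` is the letter at position `m` of the `m`-th iterate of
the morphism on the word `0`. (This iterate has length `2 ^ m > m`, and each iterate is a prefix of
the next one.) -/
def thueMorse : ℕ → Fin 2 :=
  fun m => ((fun x : List (Fin 2) => x.flatMap thueMorseMorphism)^[m] [0]).getD m 0

/-- Pairs `(i, n)`, each standing for the residue class of the integers congruent to `i`
modulo `n`. -/
def residueClasses : Finset (ℕ × ℕ) :=
  {(4, 5), (3, 7), (4, 9), (8, 9), (4, 11), (5, 11), (7, 11), (8, 11), (10, 11), (5, 13), (8, 13),
    (4, 14), (9, 14), (13, 14), (7, 15), (4, 16), (6, 16), (10, 16), (15, 16)}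

/-! ### Uniform morphisms -/

/-! Each residue class gets an explicit `n`-uniform morphism in `morphismTable`, and everything
about its image of the Thue-Morse word reduces to finite checks.

A factor of exponent above 3 with smallest period `p` gives `2 p + 1` consecutive agreements at
distance `p`. If `p ≤ n`, the factor lies in the image of some `μ²(a b)`, and a computation excludes
it (`HasNoShortPowers`). If `p > n` and `n ∤ p`, a whole letter image would reappear out of
alignment, against `IsSynchronizing`. If `p = n q` with `q ≥ 2`, the agreements descend to an
overlap in the Thue-Morse word, contradicting `thueMorse_overlapFree`.

The pseudoperiod is a condition on residues modulo `n`, so one check serves all `a ≡ i`. The density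
comes from counting uncovered residues: as 720720 = 112 · 45 · 11 · 13, the Chinese remainder
theorem gives 53 · 26 · 6 · 11 = 90948. -/

theorem getElem?_flatMap_of_uniform {α β : Type*} {n : ℕ} {h : α → List β}
    (hn : 0 < n) (hh : IsUniformMorphism n h) (l : List α) (m : ℕ) :
    (l.flatMap h)[m]? = l[m / n]?.bind fun a => (h a)[m % n]? := by
  induction l generalizing m with
  | nil => simp
  | cons a l ih =>
    rw [List.flatMap_cons, List.getElem?_append, hh a]
    split_ifs with hm
    · simp [Nat.div_eq_of_lt hm, Nat.mod_eq_of_lt hm]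
    · obtain ⟨k, rfl⟩ := Nat.exists_eq_add_of_le (not_lt.mp hm)
      rw [Nat.add_sub_cancel_left, ih, Nat.add_div_left _ hn, Nat.add_mod_left]
      simp

theorem getElem?_wordFactor_zero {α : Type*} (w : ℕ → α) {n m : ℕ} (h : m < n) :
    (wordFactor w 0 n)[m]? = some (w m) := by
  simp [wordFactor, h]

/-- The morphism whose letter images are the words of length `n` with letters `g x r`. -/
def morphismOfLetters (n : ℕ) (g : Fin 2 → ℕ → Fin 2) (x : Fin 2) : List (Fin 2) :=
  (List.range n).map (g x)

theorem isUniformMorphism_morphismOfLetters (n : ℕ) (g : Fin 2 → ℕ → Fin 2) :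
    IsUniformMorphism n (morphismOfLetters n g) := fun x => by
  simp [morphismOfLetters]

/-- The letter at position `m` of the image of `w` under the `n`-uniform morphism with letters
`g`. -/
def imageLetter (n : ℕ) (g : Fin 2 → ℕ → Fin 2) (w : ℕ → Fin 2) (m : ℕ) : Fin 2 :=
  g (w (m / n)) (m % n)

theorem morphicImage_morphismOfLetters {n : ℕ} (hn : 0 < n) (g : Fin 2 → ℕ → Fin 2)
    (w : ℕ → Fin 2) : morphicImage (morphismOfLetters n g) w = imageLetter n g w := by
  funext m
  have h1 : m / n < m + 1 := Nat.lt_succ_of_le (Nat.div_le_self m n)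
  rw [morphicImage, List.getD_eq_getElem?_getD,
    getElem?_flatMap_of_uniform hn (isUniformMorphism_morphismOfLetters n g),
    getElem?_wordFactor_zero w h1]
  simp [morphismOfLetters, imageLetter, Nat.mod_lt m hn]

theorem imageLetter_mul_add {n k r : ℕ} (hr : r < n) (g : Fin 2 → ℕ → Fin 2) (w : ℕ → Fin 2) :
    imageLetter n g w (n * k + r) = g (w k) r := by
  have hn : 0 < n := by omega
  rw [imageLetter, Nat.mul_add_div hn, Nat.mul_add_mod, Nat.div_eq_of_lt hr, Nat.mod_eq_of_lt hr,
    add_zero]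

/-! ### The Thue-Morse word -/

theorem isUniformMorphism_thueMorseMorphism : IsUniformMorphism 2 thueMorseMorphism := by
  intro a
  fin_cases a <;> rfl

/-- The `k`-th iterate of the Thue-Morse morphism on `0`. -/
def thueMorsePrefix (k : ℕ) : List (Fin 2) :=
  (fun x : List (Fin 2) => x.flatMap thueMorseMorphism)^[k] [0]

theorem thueMorsePrefix_succ (k : ℕ) :
    thueMorsePrefix (k + 1) = (thueMorsePrefix k).flatMap thueMorseMorphism := by
  rw [thueMorsePrefix, Function.iterate_succ_apply']
  rfl

theorem length_thueMorsePrefix (k : ℕ) : (thueMorsePrefix k).length = 2 ^ k := by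
  induction k with
  | zero => rfl
  | succ k ih =>
    rw [thueMorsePrefix_succ, List.length_flatMap,
      List.map_congr_left fun a _ => isUniformMorphism_thueMorseMorphism a]
    simp [ih, pow_succ]

theorem thueMorsePrefix_prefix_succ (k : ℕ) : thueMorsePrefix k <+: thueMorsePrefix (k + 1) := by
  induction k with
  | zero => exact ⟨[1], rfl⟩
  | succ k ih =>
    obtain ⟨s, hs⟩ := ih
    refine ⟨s.flatMap thueMorseMorphism, ?_⟩
    rw [thueMorsePrefix_succ (k + 1), ← hs, List.flatMap_append, ← thueMorsePrefix_succ, hs]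

theorem thueMorsePrefix_prefix {k l : ℕ} (h : k ≤ l) : thueMorsePrefix k <+: thueMorsePrefix l := by
  induction l, h using Nat.le_induction with
  | base => exact List.prefix_rfl
  | succ l _ ih => exact ih.trans (thueMorsePrefix_prefix_succ l)

theorem getElem?_thueMorsePrefix {k m : ℕ} (h : m < 2 ^ k) :
    (thueMorsePrefix k)[m]? = some (thueMorse m) := by
  have hm : (thueMorsePrefix m)[m]? = some (thueMorse m) := by
    have hlt : m < (thueMorsePrefix m).length := by
      rw [length_thueMorsePrefix]
      exact Nat.lt_two_pow_self
    rw [show thueMorse m = (thueMorsePrefix m).getD m 0 from rfl, List.getD_eq_getElem?_getD,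
      List.getElem?_eq_getElem hlt]
    rfl
  rw [← hm]
  have hk : m < (thueMorsePrefix k).length := by rwa [length_thueMorsePrefix]
  have hm' : m < (thueMorsePrefix m).length := by
    rw [length_thueMorsePrefix]
    exact Nat.lt_two_pow_self
  rcases le_total k m with hkm | hkm
  · obtain ⟨s, hs⟩ := thueMorsePrefix_prefix hkm
    rw [← hs, List.getElem?_append_left hk]
  · obtain ⟨s, hs⟩ := thueMorsePrefix_prefix hkm
    rw [← hs, List.getElem?_append_left hm']

/-- The word is fixed by its morphism: iterate `m + 1` is the image of iterate `m`, and these are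
long enough to contain positions `m` and `m / 2`. -/
theorem some_thueMorse (m : ℕ) :
    some (thueMorse m) = (thueMorseMorphism (thueMorse (m / 2)))[m % 2]? := by
  have h1 : m < 2 ^ (m + 1) := Nat.lt_two_pow_self.trans (Nat.pow_lt_pow_right one_lt_two (by omega))
  have h2 : m / 2 < 2 ^ m := (Nat.div_le_self m 2).trans_lt Nat.lt_two_pow_self
  rw [← getElem?_thueMorsePrefix h1, thueMorsePrefix_succ,
    getElem?_flatMap_of_uniform two_pos isUniformMorphism_thueMorseMorphism,
    getElem?_thueMorsePrefix h2]
  rfl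

theorem thueMorse_two_mul (k : ℕ) : thueMorse (2 * k) = thueMorse k := by
  have h := some_thueMorse (2 * k)
  rw [Nat.mul_div_cancel_left k two_pos, Nat.mul_mod_right] at h
  generalize thueMorse k = a at h ⊢
  fin_cases a <;> simpa [thueMorseMorphism] using h

theorem thueMorse_two_mul_add_one (k : ℕ) : thueMorse (2 * k + 1) = 1 - thueMorse k := by
  have h := some_thueMorse (2 * k + 1)
  rw [show (2 * k + 1) / 2 = k by omega, show (2 * k + 1) % 2 = 1 by omega] at h
  generalize thueMorse k = a at h ⊢
  fin_cases a <;> simpa [thueMorseMorphism] using h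

theorem one_sub_ne_self (a : Fin 2) : a ≠ 1 - a := by
  revert a; decide

theorem thueMorse_two_mul_ne (k : ℕ) : thueMorse (2 * k) ≠ thueMorse (2 * k + 1) := by
  rw [thueMorse_two_mul, thueMorse_two_mul_add_one]
  exact one_sub_ne_self _

theorem thueMorse_ne_succ_of_even {m : ℕ} (h : m % 2 = 0) : thueMorse m ≠ thueMorse (m + 1) := by
  obtain ⟨k, rfl⟩ : ∃ k, m = 2 * k := ⟨m / 2, by omega⟩
  exact thueMorse_two_mul_ne k

theorem thueMorse_halve {a b : ℕ} (hab : a % 2 = b % 2) (h : thueMorse a = thueMorse b) :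
    thueMorse (a / 2) = thueMorse (b / 2) := by
  have h1 : a = 2 * (a / 2) + a % 2 := by omega
  have h2 : b = 2 * (b / 2) + b % 2 := by omega
  rw [h1, h2, ← hab] at h
  rcases Nat.mod_two_eq_zero_or_one a with h0 | h0 <;> rw [h0] at h
  · simpa only [add_zero, thueMorse_two_mul] using h
  · simpa only [thueMorse_two_mul_add_one, sub_right_inj] using h

theorem thueMorse_cubeFree (i : ℕ) :
    ¬ (thueMorse i = thueMorse (i + 1) ∧ thueMorse (i + 1) = thueMorse (i + 2)) := by
  rintro ⟨h1, h2⟩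
  rcases Nat.mod_two_eq_zero_or_one i with h | h
  · exact thueMorse_ne_succ_of_even h h1
  · exact thueMorse_ne_succ_of_even (by omega : (i + 1) % 2 = 0) h2

theorem eq_of_ne_of_ne {a b c : Fin 2} (h1 : a ≠ b) (h2 : b ≠ c) : a = c := by
  revert a b c; decide

/-- The Thue-Morse word is overlap-free. -/
theorem thueMorse_overlapFree {q : ℕ} (hq : 0 < q) (i : ℕ) :
    ∃ k ≤ q, thueMorse (i + k) ≠ thueMorse (i + k + q) := by
  induction q using Nat.strong_induction_on generalizing i with
  | _ q ih =>
    by_contra! H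
    rcases Nat.mod_two_eq_zero_or_one q with hq2 | hq2
    · obtain ⟨k, hk, hne⟩ := ih (q / 2) (by omega) (by omega) (i / 2)
      refine hne ?_
      have := thueMorse_halve (by omega) (H (2 * k) (by omega))
      rwa [show (i + 2 * k) / 2 = i / 2 + k by omega,
        show (i + 2 * k + q) / 2 = i / 2 + k + q / 2 by omega] at this
    · rcases (show q = 1 ∨ 3 ≤ q by omega) with rfl | hq3
      · exact thueMorse_cubeFree i ⟨H 0 (by omega), H 1 le_rfl⟩
      · have alt : ∀ k < q, thueMorse (i + k) ≠ thueMorse (i + k + 1) ∧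
            thueMorse (i + k + q) ≠ thueMorse (i + k + q + 1) := by
          intro k hk
          have e1 := H k hk.le
          have e2 := H (k + 1) hk
          rw [← add_assoc, add_right_comm _ 1 q] at e2
          -- As `q` is odd, one of `i + k` and `i + k + q` is even; the letter changes there, and
          -- the period copies the change to the other.
          rcases Nat.mod_two_eq_zero_or_one (i + k) with h | h
          · have := thueMorse_ne_succ_of_even h
            exact ⟨this, by rwa [← e1, ← e2]⟩
          · have := thueMorse_ne_succ_of_even (by omega : (i + k + q) % 2 = 0)
            exact ⟨by rwa [e1, e2], this⟩
        have alt' : ∀ k < 2 * q, thueMorse (i + k) ≠ thueMorse (i + k + 1) := by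
          intro k hk
          rcases lt_or_ge k q with h | h
          · exact (alt k h).1
          · obtain ⟨l, rfl⟩ := Nat.exists_eq_add_of_le h
            have := (alt l (by omega)).2
            rwa [add_assoc i l q, add_comm l q] at this
        -- Five alternating letters suffice: positions `i`, `i + 2`, `i + 4` agree and have the same
        -- parity.
        have e1 := eq_of_ne_of_ne (alt' 0 (by omega)) (alt' 1 (by omega))
        have e2 := eq_of_ne_of_ne (alt' 2 (by omega)) (alt' 3 (by omega))
        refine thueMorse_cubeFree (i / 2) ⟨?_, ?_⟩
        · have := thueMorse_halve (by omega) e1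
          rwa [show (i + 0) / 2 = i / 2 by omega, show (i + 1 + 1) / 2 = i / 2 + 1 by omega] at this
        · have := thueMorse_halve (by omega) e2
          rwa [show (i + 2) / 2 = i / 2 + 1 by omega,
            show (i + 3 + 1) / 2 = i / 2 + 2 by omega] at this

/-- The letter at position `k < 8` of the image of the word `a b` under the square of the
Thue-Morse morphism. -/
def thueMorseSquare (a b : Fin 2) (k : ℕ) : Fin 2 :=
  -- The number 6 is 0110 in binary, marking the complemented letters of `μ²(a)`.
  bif Nat.ble k 3 then (bif Nat.testBit 6 k then 1 - a else a)
  else (bif Nat.testBit 6 (k - 4) then 1 - b else b)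

theorem thueMorse_four_mul_add (j k : ℕ) (hk : k < 8) :
    thueMorse (4 * j + k) = thueMorseSquare (thueMorse j) (thueMorse (j + 1)) k := by
  have h4 : ∀ j, thueMorse (4 * j) = thueMorse j := fun j => by
    rw [show 4 * j = 2 * (2 * j) by ring, thueMorse_two_mul, thueMorse_two_mul]
  have h41 : ∀ j, thueMorse (4 * j + 1) = 1 - thueMorse j := fun j => by
    rw [show 4 * j = 2 * (2 * j) by ring, thueMorse_two_mul_add_one, thueMorse_two_mul]
  have h42 : ∀ j, thueMorse (4 * j + 2) = 1 - thueMorse j := fun j => by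
    rw [show 4 * j + 2 = 2 * (2 * j + 1) by ring, thueMorse_two_mul, thueMorse_two_mul_add_one]
  have h43 : ∀ j, thueMorse (4 * j + 3) = thueMorse j := fun j => by
    rw [show 4 * j + 3 = 2 * (2 * j + 1) + 1 by ring, thueMorse_two_mul_add_one,
      thueMorse_two_mul_add_one, sub_sub_cancel]
  interval_cases k
  · exact h4 j
  · exact h41 j
  · exact h42 j
  · exact h43 j
  · exact h4 (j + 1)
  · exact h41 (j + 1)
  · exact h42 (j + 1)
  · exact h43 (j + 1)

/-! ### Avoiding powers -/

theorem avoidsPlusPowers_three_of_forall_period {α : Type*} {w : ℕ → α}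
    (h : ∀ p, 0 < p → ∀ i, ∃ j ≤ 2 * p, w (i + j) ≠ w (i + j + p)) : AvoidsPlusPowers 3 w := by
  intro i n hn
  have hlen : (wordFactor w i n).length = n := by simp [wordFactor]
  have hmem : sInf {p : ℕ | IsPeriod (wordFactor w i n) p} ∈
      {p : ℕ | IsPeriod (wordFactor w i n) p} := by
    -- The full length is a period, so the infimum is attained and is not the default 0.
    refine Nat.sInf_mem ⟨n, hn, hlen.ge, fun j hj => ?_⟩
    omega
  rw [wordExponent, hlen]
  generalize sInf {p : ℕ | IsPeriod (wordFactor w i n) p} = p at hmem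
  obtain ⟨hp, -, hper⟩ := hmem
  have hp' : (0 : ℝ) < p := by exact_mod_cast hp
  rw [div_le_iff₀ hp']
  by_contra! hlt
  have hlt' : 3 * p < n := by exact_mod_cast hlt
  obtain ⟨j, hj, hne⟩ := h p hp i
  have hjn : j < n := by omega
  have hjpn : j + p < n := by omega
  have := hper j (by rwa [hlen])
  simp only [wordFactor, List.getElem?_map, List.getElem?_range hjn, List.getElem?_range hjpn,
    Option.map_some, Option.some.injEq] at this
  exact hne (by rwa [add_assoc])

/-- No letter image occurs in the image of a two-letter word except as one of the two letter
images, and the two letter images are distinct. -/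
def IsSynchronizing (n : ℕ) (g : Fin 2 → ℕ → Fin 2) : Prop :=
  (∃ k < n, g 0 k ≠ g 1 k) ∧ ∀ x y z : Fin 2, ∀ r < n, 0 < r →
    ∃ k < n, g x k ≠ bif Nat.blt (k + r) n then g y (k + r) else g z (k + r - n)

/-- The image of every word `μ²(a b)`, where `μ` is the Thue-Morse morphism, contains no factor of
length `3 p + 1` with period `p ≤ n`. -/
def HasNoShortPowers (n : ℕ) (g : Fin 2 → ℕ → Fin 2) : Prop :=
  ∀ a b : Fin 2, ∀ p < n + 1, 0 < p → ∀ s < 4 * n, ∃ j < 2 * p + 1,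
    imageLetter n g (thueMorseSquare a b) (s + j) ≠
      imageLetter n g (thueMorseSquare a b) (s + j + p)

theorem imageLetter_thueMorse {n : ℕ} (g : Fin 2 → ℕ → Fin 2) (m s : ℕ)
    (hs : s < 8 * n) :
    imageLetter n g thueMorse (4 * n * m + s) =
      imageLetter n g (thueMorseSquare (thueMorse m) (thueMorse (m + 1))) s := by
  have hn : 0 < n := by omega
  have h8 : s / n < 8 := by rwa [Nat.div_lt_iff_lt_mul hn]
  rw [imageLetter, imageLetter, show 4 * n * m + s = n * (4 * m) + s by ring,
    Nat.mul_add_div hn, Nat.mul_add_mod, thueMorse_four_mul_add m _ h8]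

/-- Cut the word into blocks of length `4 n`. A window starting at `s < 4 n` reaches at most `s + 3
p < 7 n`, so two consecutive blocks contain it. -/
theorem HasNoShortPowers.exists_ne {n : ℕ} {g : Fin 2 → ℕ → Fin 2} (hg : HasNoShortPowers n g)
    {p : ℕ} (hp : 0 < p) (hpn : p ≤ n) (i : ℕ) :
    ∃ j ≤ 2 * p, imageLetter n g thueMorse (i + j) ≠ imageLetter n g thueMorse (i + j + p) := by
  have h4 : 0 < 4 * n := by omega
  have hs := Nat.mod_lt i h4
  have hi := Nat.div_add_mod i (4 * n)
  generalize i % (4 * n) = s at hs hi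
  generalize i / (4 * n) = m at hi
  subst hi
  obtain ⟨j, hj, hne⟩ := hg (thueMorse m) (thueMorse (m + 1)) p (by omega) hp s hs
  refine ⟨j, by omega, ?_⟩
  rw [show 4 * n * m + s + j = 4 * n * m + (s + j) by ring,
    show 4 * n * m + (s + j) + p = 4 * n * m + (s + j + p) by ring,
    imageLetter_thueMorse g m _ (by omega), imageLetter_thueMorse g m _ (by omega)]
  exact hne

/-- The first full letter image after position `i` ends within `2 n ≤ 2 p` letters; shifted by `p`,
it straddles two letter images. -/
theorem IsSynchronizing.exists_ne_of_not_dvd {n : ℕ} {g : Fin 2 → ℕ → Fin 2}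
    (hg : IsSynchronizing n g) (hn : 0 < n) (u : ℕ → Fin 2) {p : ℕ} (hp : ¬ n ∣ p) (hnp : n ≤ p)
    (i : ℕ) : ∃ j ≤ 2 * p, imageLetter n g u (i + j) ≠ imageLetter n g u (i + j + p) := by
  have hr0 : 0 < p % n := Nat.pos_of_ne_zero fun h => hp (Nat.dvd_of_mod_eq_zero h)
  have hr := Nat.mod_lt p hn
  have hpd := Nat.div_add_mod p n
  have hi := Nat.div_add_mod i n
  have hs := Nat.mod_lt i hn
  generalize p % n = r at *
  generalize p / n = q at *
  generalize i % n = s at *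
  generalize i / n = m at *
  obtain ⟨k, hk, hne⟩ := hg.2 (u (m + 1)) (u (m + 1 + q)) (u (m + 1 + q + 1)) r hr hr0
  have e1 : i + (n - s + k) = n * (m + 1) + k := by
    rw [← hi, mul_add, mul_one]
    omega
  refine ⟨n - s + k, by omega, ?_⟩
  rw [e1, imageLetter_mul_add hk]
  by_cases hkr : k + r < n
  · rw [show n * (m + 1) + k + p = n * (m + 1 + q) + (k + r) by rw [← hpd]; ring,
      imageLetter_mul_add hkr]
    rwa [Nat.blt_eq.mpr hkr, cond_true] at hne
  · have e2 : n * (m + 1) + k + p = n * (m + 1 + q + 1) + (k + r - n) := by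
      rw [← hpd, mul_add n (m + 1 + q), mul_add n (m + 1) q]
      omega
    rw [e2, imageLetter_mul_add (by omega)]
    have hb : Nat.blt (k + r) n = false := by
      rw [Bool.eq_false_iff, ne_eq, Nat.blt_eq]
      exact hkr
    rwa [hb, cond_false] at hne

/-- Reaching a block boundary, moving `l ≤ q` blocks and then to a distinguishing position takes
less than `n + n q + n ≤ 2 n q` letters, since `q ≥ 2`. -/
theorem IsSynchronizing.exists_ne_of_eq_mul {n : ℕ} {g : Fin 2 → ℕ → Fin 2}
    (hg : IsSynchronizing n g) {q : ℕ} (hq : 2 ≤ q) (i : ℕ) :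
    ∃ j ≤ 2 * (n * q),
      imageLetter n g thueMorse (i + j) ≠ imageLetter n g thueMorse (i + j + n * q) := by
  obtain ⟨⟨k, hk, hne⟩, -⟩ := hg
  have hn : 0 < n := by omega
  have hi := Nat.div_add_mod i n
  have hs := Nat.mod_lt i hn
  generalize i % n = s at *
  generalize i / n = m at *
  obtain ⟨l, hl, hlne⟩ := thueMorse_overlapFree (by omega : 0 < q) (m + 1)
  have e1 : i + (n - s + n * l + k) = n * (m + 1 + l) + k := by
    rw [← hi, mul_add, mul_add, mul_one]
    omega
  have hb : n * l + 2 * n ≤ 2 * (n * q) := by nlinarith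
  refine ⟨n - s + n * l + k, by omega, ?_⟩
  rw [e1, show n * (m + 1 + l) + k + n * q = n * (m + 1 + l + q) + k by ring,
    imageLetter_mul_add hk, imageLetter_mul_add hk]
  generalize thueMorse (m + 1 + l) = a at hlne
  generalize thueMorse (m + 1 + l + q) = b at hlne
  fin_cases a <;> fin_cases b
  · exact absurd rfl hlne
  · exact hne
  · exact hne.symm
  · exact absurd rfl hlne

theorem avoidsPlusPowers_imageLetter {n : ℕ} {g : Fin 2 → ℕ → Fin 2}
    (hs : IsSynchronizing n g) (hg : HasNoShortPowers n g) :
    AvoidsPlusPowers 3 (imageLetter n g thueMorse) := by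
  refine avoidsPlusPowers_three_of_forall_period fun p hp i => ?_
  rcases le_or_gt p n with hpn | hpn
  · exact hg.exists_ne hp hpn i
  · have hn : 0 < n := by
      obtain ⟨⟨k, hk, -⟩, -⟩ := hs
      omega
    by_cases hd : n ∣ p
    · obtain ⟨q, rfl⟩ := hd
      exact hs.exists_ne_of_eq_mul (by nlinarith) i
    · exact hs.exists_ne_of_not_dvd hn _ hd hpn.le i

/-! ### Pseudoperiods -/

/-- Whenever a letter of the image of a word differs from the next one, it is equal to all letters
of the image whose positions are larger by `i` modulo `n`. -/
def HasUniformPseudoperiod (n i : ℕ) (g : Fin 2 → ℕ → Fin 2) : Prop :=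
  ∀ x y z : Fin 2, ∀ r < n,
    (g x r = bif Nat.blt (r + 1) n then g x (r + 1) else g z 0) ∨ g x r = g y ((r + i) % n)

/-- The letter `a` places later may lie in any letter image, whence the arbitrary `y`; its place
there depends only on `a` modulo `n`. -/
theorem HasUniformPseudoperiod.hasPseudoperiod {n i : ℕ} {g : Fin 2 → ℕ → Fin 2}
    (hg : HasUniformPseudoperiod n i g) (hn : 0 < n) (u : ℕ → Fin 2) {a : ℕ} (ha : 2 ≤ a)
    (hai : a ≡ i [MOD n]) : HasPseudoperiod (imageLetter n g u) ![1, a] := by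
  refine ⟨two_pos, fun j => ?_, ?_, fun m => ?_⟩
  · fin_cases j
    · exact one_pos
    · exact lt_of_lt_of_le two_pos ha
  · intro j k hjk
    fin_cases j <;> fin_cases k
    · exact absurd hjk (lt_irrefl _)
    · exact ha
    · exact absurd hjk (by decide)
    · exact absurd hjk (lt_irrefl _)
  · have hr := Nat.mod_lt m hn
    have hm := Nat.div_add_mod m n
    rcases hg (u (m / n)) (u ((m + a) / n)) (u (m / n + 1)) (m % n) hr with h | h
    · refine ⟨0, ?_⟩
      change imageLetter n g u m = imageLetter n g u (m + 1)
      rw [imageLetter, h]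
      by_cases hlt : m % n + 1 < n
      · rw [Nat.blt_eq.mpr hlt, cond_true, show m + 1 = n * (m / n) + (m % n + 1) by omega,
          imageLetter_mul_add hlt]
      · have hb : Nat.blt (m % n + 1) n = false := by
          rw [Bool.eq_false_iff, ne_eq, Nat.blt_eq]
          exact hlt
        have e : m + 1 = n * (m / n + 1) + 0 := by
          rw [mul_add]
          omega
        rw [hb, cond_false, e, imageLetter_mul_add hn]
    · refine ⟨1, ?_⟩
      change imageLetter n g u m = imageLetter n g u (m + a)
      have e : (m + a) % n = (m % n + i) % n := (Nat.mod_modEq m n).symm.add hai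
      rw [imageLetter, h, imageLetter, e]

/-! ### The morphisms -/

/-- The letter images of a morphism, encoded as the binary expansions of `c` and `d`, least
significant digit first. -/
def binaryLetters (c d : ℕ) (x : Fin 2) (r : ℕ) : Fin 2 :=
  bif Nat.testBit (bif Nat.beq x 0 then c else d) r then 1 else 0

/-- Quadruples `(i, n, c, d)`: a residue class `i` modulo `n` and a binary code of an `n`-uniform
morphism. -/
def morphismTable : List (ℕ × ℕ × ℕ × ℕ) :=
  [(4, 5, 0b11000, 0b11100),
    (3, 7, 0b1100100, 0b1101100),
    (4, 9, 0b110001000, 0b110011000),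
    (8, 9, 0b110011000, 0b110011100),
    (4, 11, 0b11100011000, 0b11100111000),
    (5, 11, 0b11100011000, 0b11100111000),
    (7, 11, 0b10011001000, 0b10011001100),
    (8, 11, 0b10110100100, 0b10110110100),
    (10, 11, 0b11100011000, 0b11100111000),
    (5, 13, 0b1011010010100, 0b1011010110100),
    (8, 13, 0b1100110001000, 0b1100111001000),
    (4, 14, 0b11000110001000, 0b11100110001000),
    (9, 14, 0b11000110001000, 0b11000110011100),
    (13, 14, 0b11001110011000, 0b11001100011100),
    (7, 15, 0b110110001001000, 0b110110011001000),
    (4, 16, 0b1110001110001000, 0b1110001110011000),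
    (6, 16, 0b1011101000101000, 0b1011101001101000),
    (10, 16, 0b1110001110001000, 0b1110001110011000),
    (15, 16, 0b1110011100011000, 0b1110001110011000)]

theorem isSynchronizing_of_mem_morphismTable :
    ∀ e ∈ morphismTable, IsSynchronizing e.2.1 (binaryLetters e.2.2.1 e.2.2.2) := by
  unfold IsSynchronizing
  decide +kernel

/-- The number whose binary digits are the letters of the image of `μ²(a b)`, where `μ` is the
Thue-Morse morphism. -/
def imageCode (n : ℕ) (g : Fin 2 → ℕ → Fin 2) (a b : Fin 2) : ℕ :=
  Nat.ofBits fun k : Fin (8 * n) => imageLetter n g (thueMorseSquare a b) k == 1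

theorem testBit_imageCode {n s : ℕ} (g : Fin 2 → ℕ → Fin 2) (a b : Fin 2) (hs : s < 8 * n) :
    (imageCode n g a b).testBit s = (imageLetter n g (thueMorseSquare a b) s == 1) :=
  Nat.testBit_ofBits_lt _ _ hs

/-- The bitwise disjunction of `D >>> j` for `j < 2 ^ k`. -/
def shiftOr (D : ℕ) : ℕ → ℕ
  | 0 => D
  | k + 1 => shiftOr D k ||| shiftOr D k >>> 2 ^ k

theorem exists_testBit_of_testBit_shiftOr {D k s : ℕ} (h : (shiftOr D k).testBit s) :
    ∃ j < 2 ^ k, D.testBit (s + j) := by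
  induction k generalizing s with
  | zero => exact ⟨0, one_pos, h⟩
  | succ k ih =>
    rw [shiftOr, Nat.testBit_or, Nat.testBit_shiftRight, Bool.or_eq_true] at h
    rw [pow_succ]
    rcases h with h | h
    · obtain ⟨j, hj, hjs⟩ := ih h
      exact ⟨j, by omega, hjs⟩
    · obtain ⟨j, hj, hjs⟩ := ih h
      exact ⟨2 ^ k + j, by omega, by rwa [← add_assoc, add_comm s]⟩

/-- The test that every window of `2 p + 1` binary digits of `C` that starts at a position less than
`m` contains a digit which differs from the digit `p` positions later. -/
def everyWindowMismatches (C p m : ℕ) : Bool :=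
  -- Digits 1 of `C ^^^ C >>> p` mark mismatches. A window of length `2 p + 1` is covered by two
  -- overlapping windows whose length is the largest power of two not exceeding it.
  let X := shiftOr (C ^^^ C >>> p) (Nat.log2 (2 * p + 1))
  (X ||| X >>> (2 * p + 1 - 2 ^ Nat.log2 (2 * p + 1))) % 2 ^ m == 2 ^ m - 1

theorem exists_testBit_ne_of_everyWindowMismatches {C p m s : ℕ}
    (h : everyWindowMismatches C p m) (hs : s < m) :
    ∃ j < 2 * p + 1, C.testBit (s + j) ≠ C.testBit (s + j + p) := by
  have hk : 2 ^ Nat.log2 (2 * p + 1) ≤ 2 * p + 1 := Nat.log2_self_le (by omega)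
  have h1 := congrArg (fun x => Nat.testBit x s) (eq_of_beq h)
  simp only [Nat.testBit_mod_two_pow, Nat.testBit_two_pow_sub_one, hs, decide_true, Bool.true_and,
    Nat.testBit_or, Nat.testBit_shiftRight, Bool.or_eq_true] at h1
  have h2 : ∃ j < 2 * p + 1, (C ^^^ C >>> p).testBit (s + j) := by
    rcases h1 with h1 | h1
    · obtain ⟨j, hj, hjs⟩ := exists_testBit_of_testBit_shiftOr h1
      exact ⟨j, by omega, hjs⟩
    · obtain ⟨j, hj, hjs⟩ := exists_testBit_of_testBit_shiftOr h1
      exact ⟨2 * p + 1 - 2 ^ Nat.log2 (2 * p + 1) + j, by omega, by rwa [← add_assoc, add_comm s]⟩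
  obtain ⟨j, hj, hjs⟩ := h2
  refine ⟨j, hj, fun he => ?_⟩
  rw [Nat.testBit_xor, Nat.testBit_shiftRight, add_comm p, he, Bool.xor_self] at hjs
  exact Bool.false_ne_true hjs

theorem hasNoShortPowers_of_imageCode {n : ℕ} {g : Fin 2 → ℕ → Fin 2}
    (h : ∀ a b : Fin 2, ∀ p < n + 1, 0 < p → everyWindowMismatches (imageCode n g a b) p (4 * n)) :
    HasNoShortPowers n g := by
  intro a b p hpn hp s hs
  obtain ⟨j, hj, hne⟩ := exists_testBit_ne_of_everyWindowMismatches (h a b p hpn hp) hs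
  refine ⟨j, hj, fun he => hne ?_⟩
  rw [testBit_imageCode g a b (by omega), testBit_imageCode g a b (by omega), he]

theorem hasNoShortPowers_of_mem_morphismTable :
    ∀ e ∈ morphismTable, HasNoShortPowers e.2.1 (binaryLetters e.2.2.1 e.2.2.2) := by
  have h : ∀ e ∈ morphismTable, ∀ a b : Fin 2, ∀ p < e.2.1 + 1, 0 < p →
      everyWindowMismatches (imageCode e.2.1 (binaryLetters e.2.2.1 e.2.2.2) a b) p
        (4 * e.2.1) := by
    decide +kernel
  exact fun e he => hasNoShortPowers_of_imageCode (h e he)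

theorem hasUniformPseudoperiod_of_mem_morphismTable :
    ∀ e ∈ morphismTable, HasUniformPseudoperiod e.2.1 e.1 (binaryLetters e.2.2.1 e.2.2.2) := by
  unfold HasUniformPseudoperiod
  decide +kernel

theorem exists_mem_morphismTable :
    ∀ c ∈ residueClasses, ∃ e ∈ morphismTable, e.1 = c.1 ∧ e.2.1 = c.2 := by
  decide +kernel

theorem exists_uniformMorphism_of_mem_residueClasses {i n : ℕ} (h : (i, n) ∈ residueClasses) :
    ∃ h : Fin 2 → List (Fin 2), IsUniformMorphism n h ∧
      AvoidsPlusPowers 3 (morphicImage h thueMorse) ∧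
      ∀ a : ℕ, 3 ≤ a → a ≡ i [MOD n] →
        HasPseudoperiod (morphicImage h thueMorse) ![1, a] := by
  obtain ⟨e, he, rfl, rfl⟩ := exists_mem_morphismTable _ h
  have hs := isSynchronizing_of_mem_morphismTable e he
  have hn : 0 < e.2.1 := by
    obtain ⟨⟨k, hk, -⟩, -⟩ := hs
    omega
  refine ⟨morphismOfLetters e.2.1 (binaryLetters e.2.2.1 e.2.2.2),
    isUniformMorphism_morphismOfLetters _ _, ?_, fun a ha hai => ?_⟩
  · rw [morphicImage_morphismOfLetters hn]
    exact avoidsPlusPowers_imageLetter hs (hasNoShortPowers_of_mem_morphismTable e he)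
  · rw [morphicImage_morphismOfLetters hn]
    exact (hasUniformPseudoperiod_of_mem_morphismTable e he).hasPseudoperiod hn _ (by omega) hai

/-! ### Counting residues -/

theorem card_filter_range_of_eq_mul_of_coprime {N m n k l : ℕ} (hN : N = m * n) (hm : 0 < m)
    (hn : 0 < n) (h : m.Coprime n) {P Q : ℕ → Prop} [DecidablePred P] [DecidablePred Q]
    (hP : {r ∈ Finset.range m | P r}.card = k) (hQ : {r ∈ Finset.range n | Q r}.card = l) :
    {r ∈ Finset.range N | P (r % m) ∧ Q (r % n)}.card = k * l := by
  subst hN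
  rw [← hP, ← hQ, ← Finset.card_product]
  refine Finset.card_bij (fun r _ => (r % m, r % n)) ?_ ?_ ?_
  · intro r hr
    rw [Finset.mem_filter] at hr
    simp [Nat.mod_lt _ hm, Nat.mod_lt _ hn, hr.2]
  · intro r hr s hs hrs
    rw [Finset.mem_filter, Finset.mem_range] at hr hs
    rw [Prod.mk.injEq] at hrs
    exact ((Nat.modEq_and_modEq_iff_modEq_mul h).mp hrs).eq_of_lt_of_lt hr.1 hs.1
  · rintro ⟨a, b⟩ hab
    simp only [Finset.mem_product, Finset.mem_filter, Finset.mem_range] at hab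
    obtain ⟨⟨ha, hPa⟩, hb, hQb⟩ := hab
    obtain ⟨h1, h2⟩ := (Nat.chineseRemainder h a b).2
    have e1 : (Nat.chineseRemainder h a b : ℕ) % m = a := Eq.trans h1 (Nat.mod_eq_of_lt ha)
    have e2 : (Nat.chineseRemainder h a b : ℕ) % n = b := Eq.trans h2 (Nat.mod_eq_of_lt hb)
    refine ⟨Nat.chineseRemainder h a b, ?_, by rw [e1, e2]⟩
    rw [Finset.mem_filter, Finset.mem_range, e1, e2]
    exact ⟨Nat.chineseRemainder_lt_mul h a b hm.ne' hn.ne', hPa, hQb⟩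

/-- `r` belongs to a residue class of `residueClasses` whose modulus divides `m`. -/
def IsCovered (m r : ℕ) : Prop :=
  ∃ c ∈ residueClasses, c.2 ∣ m ∧ r ≡ c.1 [MOD c.2]

instance (m r : ℕ) : Decidable (IsCovered m r) :=
  inferInstanceAs (Decidable (∃ c ∈ residueClasses, c.2 ∣ m ∧ r ≡ c.1 [MOD c.2]))

theorem isCovered_mod {m k : ℕ} (h : m ∣ k) (r : ℕ) : IsCovered m (r % k) ↔ IsCovered m r := by
  refine exists_congr fun c => and_congr_right fun _ => and_congr_right fun hc => ?_
  have : r % k ≡ r [MOD c.2] := (Nat.mod_modEq r k).of_dvd (hc.trans h)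
  exact ⟨this.symm.trans, this.trans⟩

theorem dvd_of_mem_residueClasses :
    ∀ c ∈ residueClasses, c.2 ∣ 720720 ∧ (c.2 ∣ 112 ∨ c.2 ∣ 45 ∨ c.2 ∣ 11 ∨ c.2 ∣ 13) := by
  decide

theorem isCovered_iff (r : ℕ) :
    (∃ c ∈ residueClasses, r ≡ c.1 [MOD c.2]) ↔ IsCovered 720720 r :=
  exists_congr fun c => and_congr_right fun hc => by
    simp [(dvd_of_mem_residueClasses c hc).1]

/-- Every modulus divides one of the pairwise coprime numbers 112, 45, 11, 13, so being uncovered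
splits into four independent conditions, paired here for two rounds of the Chinese remainder
theorem. -/
theorem not_isCovered_iff (r : ℕ) :
    ¬ IsCovered 720720 r ↔
      (¬ IsCovered 112 (r % 5040 % 112) ∧ ¬ IsCovered 45 (r % 5040 % 45)) ∧
        (¬ IsCovered 11 (r % 143 % 11) ∧ ¬ IsCovered 13 (r % 143 % 13)) := by
  simp only [isCovered_mod dvd_rfl, isCovered_mod (show 112 ∣ 5040 by norm_num),
    isCovered_mod (show 45 ∣ 5040 by norm_num), isCovered_mod (show 11 ∣ 143 by norm_num),
    isCovered_mod (show 13 ∣ 143 by norm_num), ← not_or, not_iff_not]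
  constructor
  · rintro ⟨c, hc, -, hr⟩
    rcases (dvd_of_mem_residueClasses c hc).2 with h | h | h | h
    · exact Or.inl (Or.inl ⟨c, hc, h, hr⟩)
    · exact Or.inl (Or.inr ⟨c, hc, h, hr⟩)
    · exact Or.inr (Or.inl ⟨c, hc, h, hr⟩)
    · exact Or.inr (Or.inr ⟨c, hc, h, hr⟩)
  · rintro ((⟨c, hc, -, hr⟩ | ⟨c, hc, -, hr⟩) | (⟨c, hc, -, hr⟩ | ⟨c, hc, -, hr⟩)) <;>
      exact ⟨c, hc, (dvd_of_mem_residueClasses c hc).1, hr⟩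

theorem card_not_isCovered_112 : {r ∈ Finset.range 112 | ¬ IsCovered 112 r}.card = 53 := by
  decide +kernel

theorem card_not_isCovered_45 : {r ∈ Finset.range 45 | ¬ IsCovered 45 r}.card = 26 := by
  decide +kernel

theorem card_not_isCovered_11 : {r ∈ Finset.range 11 | ¬ IsCovered 11 r}.card = 6 := by
  decide +kernel

theorem card_not_isCovered_13 : {r ∈ Finset.range 13 | ¬ IsCovered 13 r}.card = 11 := by
  decide +kernel

theorem card_not_isCovered {N : ℕ} (hN : N = 720720) :
    {r ∈ Finset.range N | ¬ IsCovered 720720 r}.card = 90948 := by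
  rw [Finset.filter_congr fun r _ => not_isCovered_iff r]
  have h1 := card_filter_range_of_eq_mul_of_coprime (N := 5040) (m := 112) (n := 45) (by norm_num)
    (by norm_num) (by norm_num) (by norm_num) card_not_isCovered_112 card_not_isCovered_45
  have h2 := card_filter_range_of_eq_mul_of_coprime (N := 143) (m := 11) (n := 13) (by norm_num)
    (by norm_num) (by norm_num) (by norm_num) card_not_isCovered_11 card_not_isCovered_13
  exact card_filter_range_of_eq_mul_of_coprime (hN.trans (by norm_num)) (by norm_num)
    (by norm_num) (by norm_num) h1 h2

theorem card_isCovered {N : ℕ} (hN : N = 720720) :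
    {r ∈ Finset.range N | IsCovered 720720 r}.card = 629772 := by
  have h : {r ∈ Finset.range N | IsCovered 720720 r}.card +
      {r ∈ Finset.range N | ¬ IsCovered 720720 r}.card = (Finset.range N).card :=
    Finset.card_filter_add_card_filter_not _
  rw [card_not_isCovered hN, Finset.card_range] at h
  omega

theorem card_isCovered_Ico {N : ℕ} (hN : N = 720720) (k : ℕ) :
    {a ∈ Finset.Ico 3 (3 + N * k) | IsCovered 720720 a}.card = 629772 * k := by
  induction k with
  | zero => simp
  | succ k ih =>
    have hper : Function.Periodic (IsCovered 720720) N := fun r => by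
      rw [← isCovered_mod (dvd_of_eq hN.symm), Nat.add_mod_right,
        isCovered_mod (dvd_of_eq hN.symm)]
    have hb := Nat.filter_Ico_card_eq_of_periodic (3 + N * k) N _ hper
    rw [Nat.count_eq_card_filter_range, card_isCovered hN] at hb
    rw [mul_add, mul_one, ← add_assoc, ← Finset.Ico_union_Ico_eq_Ico (b := 3 + N * k)
      (by omega) (by omega), Finset.filter_union, Finset.card_union_of_disjoint, ih, hb, mul_add]
    exact Finset.disjoint_filter_filter (Finset.Ico_disjoint_Ico_consecutive _ _ _)

theorem mainTheorem10 :
    (∀ᶠ N : ℕ in Filter.atTop,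
      (85 / 100 : ℝ) * ((Set.Icc 3 N).ncard : ℝ) ≤
        ({a : ℕ | a ∈ Set.Icc 3 N ∧
          ∃ w : ℕ → Fin 2, HasPseudoperiod w ![1, a] ∧ AvoidsPlusPowers 3 w}.ncard : ℝ)) ∧
    (∀ i n : ℕ, (i, n) ∈ residueClasses →
      ∃ h : Fin 2 → List (Fin 2), IsUniformMorphism n h ∧
        AvoidsPlusPowers 3 (morphicImage h thueMorse) ∧
        ∀ a : ℕ, 3 ≤ a → a ≡ i [MOD n] →
          HasPseudoperiod (morphicImage h thueMorse) ![1, a]) ∧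
    {r ∈ Finset.range 720720 | ∃ c ∈ residueClasses, r ≡ c.1 [MOD c.2]}.card = 629772 := by
  refine ⟨?_, fun i n => exists_uniformMorphism_of_mem_residueClasses, ?_⟩
  -- Each full period has a surplus 100 · 629772 − 85 · 720720 = 1716000; 36 of them outweigh the at
  -- most 85 · 720719 lost to the incomplete last period.
  · filter_upwards [Filter.eventually_ge_atTop (3 + 720720 * 36)] with N hN
    obtain ⟨M, hM⟩ : ∃ M, M = 720720 := ⟨_, rfl⟩
    -- The interval from 3 to `N` has `N - 2` elements, so `k` counts its full periods.
    obtain ⟨k, hk⟩ : ∃ k, k = (N - 2) / 720720 := ⟨_, rfl⟩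
    have hcard : (Set.Icc 3 N).ncard = N + 1 - 3 := by
      rw [← Finset.coe_Icc, Set.ncard_coe_finset, Nat.card_Icc]
    have hle : 629772 * k ≤ {a : ℕ | a ∈ Set.Icc 3 N ∧
        ∃ w : ℕ → Fin 2, HasPseudoperiod w ![1, a] ∧ AvoidsPlusPowers 3 w}.ncard := by
      rw [← card_isCovered_Ico hM k, ← Set.ncard_coe_finset]
      refine Set.ncard_le_ncard (fun a ha => ?_) ((Set.finite_Icc 3 N).subset fun a ha => ha.1)
      rw [Finset.mem_coe, Finset.mem_filter, Finset.mem_Ico] at ha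
      obtain ⟨⟨ha3, haN⟩, c, hc, -, hac⟩ := ha
      obtain ⟨h, -, hpow, hper⟩ := exists_uniformMorphism_of_mem_residueClasses hc
      exact ⟨⟨ha3, by rw [hM] at haN; omega⟩, _, hper a ha3 hac, hpow⟩
    have hnat : 85 * (N + 1 - 3) ≤ 100 * (629772 * k) := by omega
    rw [hcard]
    have h1 : (85 : ℝ) * ((N + 1 - 3 : ℕ) : ℝ) ≤ 100 * ((629772 * k : ℕ) : ℝ) := by
      exact_mod_cast hnat
    have h2 : ((629772 * k : ℕ) : ℝ) ≤ ({a : ℕ | a ∈ Set.Icc 3 N ∧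
        ∃ w : ℕ → Fin 2, HasPseudoperiod w ![1, a] ∧ AvoidsPlusPowers 3 w}.ncard : ℝ) := by
      exact_mod_cast hle
    linarith
  · generalize hN : 720720 = N
    simp only [isCovered_iff]
    exact card_isCovered hN.symm
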